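/- Let $x=(x_j)_{j\in\mathbb Z}\in[1,2]^{\mathbb Z}$. On $\ell^2(\mathbb Z)$ with standard orthonormal basis $(e_j)_{j\in\mathbb Z}$ consider the bilateral shift $Te_j=e_{j+1}$, the weighted shift $T_xe_j=x_je_{j+1}$, and the diagonal operators $X_ie_j=x_{i+j}e_j$ ($i\in\mathbb Z$). For a set $S$ of bounded operators let $C^*(S)$ be the C*-algebra generated by $1$ and $S$. Let $X\subset\mathbb C^{\mathbb Z}$ be the closure, in the product topology, of the set of sequences $b_i=(x_{i+j})_{j\in\mathbb Z}$, $i\in\mathbb Z$. Then: 1. There is a $*$-isomorphism $C^*(\{X_i\}_{i\in\mathbb Z})\cong C(X)$ taking each $X_i$ to the $i$-th coordinate function on $X$. 2. Let $\mathbb Z$ act on $C(X)=C^*(\{X_i\}_{i\in\mathbb Z})$ through the automorphism $\alpha(a)=TaT^{-1}$, so that $\alpha(X_i)=X_{i-1}$, and let $C(X)\rtimes\mathbb Z$ be the (full) crossed product, that is, the completion of the $*$-algebra of finite sums $\sum_n a_nu^n$ ($a_n\in C(X)$, $u$ unitary, $uau^{-1}=\alpha(a)$) in the supremum of the norms given by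 all covariant representations. Then there is a $*$-isomorphism $C(X)\rtimes\mathbb Z\cong C^*(T_x)$ which is the identity on $C(X)$ (regarded as an algebra of operators on $\ell^2(\mathbb Z)$) and takes $u$ to $T$. -/

import Mathlib

open scoped ENNReal

noncomputable section

/-! ## Crossed products of unital C*-algebras by discrete groups -/

section Crossed

universe u v

/-- An action of a discrete group `G` on a unital C*-algebra `A` by `*`-automorphisms. -/
class CStarAction (G : Type v) (A : Type u) [Group G] [CStarAlgebra A] extends
    MulSemiringAction G A, SMulCommClass G ℂ A where
  smul_star_eq : ∀ (g : G) (a : A), g • star a = star (g • a)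

/-- The algebraic crossed product: finitely supported functions `G → A`, written as finite sums
`∑ a_g g`, with product `(a g) (b h) = (a (g • b)) (g h)`. -/
abbrev AlgCrossedProduct (A : Type u) (G : Type v) [CStarAlgebra A] : Type (max v u) :=
  SkewMonoidAlgebra A G

namespace AlgCrossedProduct

variable {A : Type u} {G : Type v} [Group G] [CStarAlgebra A] [CStarAction G A]

/-- The involution `(a g)* = (g⁻¹ • a*) g⁻¹`. -/
instance instStar : Star (AlgCrossedProduct A G) where
  star f := f.sum fun g a => SkewMonoidAlgebra.single g⁻¹ (g⁻¹ • star a)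

theorem star_single (g : G) (a : A) :
    star (SkewMonoidAlgebra.single g a : AlgCrossedProduct A G) =
      SkewMonoidAlgebra.single g⁻¹ (g⁻¹ • star a) :=
  SkewMonoidAlgebra.sum_single_index (by simp)

theorem star_add' (f h : AlgCrossedProduct A G) : star (f + h) = star f + star h := by
  classical
  exact SkewMonoidAlgebra.sum_add_index (fun _ _ => by simp) (fun _ _ _ _ => by simp)

theorem star_zero' : star (0 : AlgCrossedProduct A G) = 0 :=
  SkewMonoidAlgebra.sum_zero_index

instance instStarRing : StarRing (AlgCrossedProduct A G) where
  star_involutive f := by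
    induction f using SkewMonoidAlgebra.induction_on' with
    | single g a => simp [star_single, ← CStarAction.smul_star_eq]
    | add f h hf hh => simp [star_add', hf, hh]
  star_mul f h := by
    induction f using SkewMonoidAlgebra.induction_on' with
    | single g a =>
      induction h using SkewMonoidAlgebra.induction_on' with
      | single k b =>
        simp [star_single, SkewMonoidAlgebra.single_mul_single, mul_smul,
          ← CStarAction.smul_star_eq]
      | add f h hf hh => simp [mul_add, add_mul, star_add', hf, hh]
    | add f h hf hh => simp [mul_add, add_mul, star_add', hf, hh]
  star_add := star_add'

instance instStarModule : StarModule ℂ (AlgCrossedProduct A G) where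
  star_smul c f := by
    induction f using SkewMonoidAlgebra.induction_on' with
    | single g a =>
      rw [SkewMonoidAlgebra.smul_single, star_single, star_single, SkewMonoidAlgebra.smul_single,
        star_smul, smul_comm]
    | add f h hf hh => simp only [smul_add, star_add, hf, hh]

end AlgCrossedProduct

/-- A covariant representation of `(A, G)` on a Hilbert space `H`: a unital `*`-representation `π`
of `A` and a unitary representation `U` of `G` such that `π (g • a) U_g = U_g π a`. -/
structure CovariantRep (G : Type v) (A : Type u) [Group G] [CStarAlgebra A] [CStarAction G A] where
  H : Type (max v u)
  [normed : NormedAddCommGroup H]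
  [inner : InnerProductSpace ℂ H]
  [complete : CompleteSpace H]
  π : A →⋆ₐ[ℂ] (H →L[ℂ] H)
  U : G →* unitary (H →L[ℂ] H)
  covariant : ∀ (g : G) (a : A), π (g • a) * (U g : H →L[ℂ] H) = (U g : H →L[ℂ] H) * π a

attribute [instance] CovariantRep.normed CovariantRep.inner CovariantRep.complete

namespace CovariantRep

variable {A : Type u} {G : Type v} [Group G] [CStarAlgebra A] [CStarAction G A]

/-- The integrated form `∑ a_g g ↦ ∑ π(a_g) U_g`. -/
def integrated (r : CovariantRep G A) : AlgCrossedProduct A G →+* (r.H →L[ℂ] r.H) :=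
  SkewMonoidAlgebra.liftNCRingHom (r.π : A →+* (r.H →L[ℂ] r.H))
    ((unitary (r.H →L[ℂ] r.H)).subtype.comp r.U) (fun {a g} => r.covariant g a)

theorem integrated_single (r : CovariantRep G A) (g : G) (a : A) :
    r.integrated (SkewMonoidAlgebra.single g a) = r.π a * (r.U g : r.H →L[ℂ] r.H) :=
  SkewMonoidAlgebra.liftNC_single _ _ _ _

theorem integrated_smul (r : CovariantRep G A) (c : ℂ) (f : AlgCrossedProduct A G) :
    r.integrated (c • f) = c • r.integrated f := by
  induction f using SkewMonoidAlgebra.induction_on' with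
  | single g a => simp [SkewMonoidAlgebra.smul_single, integrated_single]
  | add f h hf hh => simp only [smul_add, map_add, hf, hh]

theorem integrated_star (r : CovariantRep G A) (f : AlgCrossedProduct A G) :
    r.integrated (star f) = star (r.integrated f) := by
  induction f using SkewMonoidAlgebra.induction_on' with
  | single g a =>
    rw [AlgCrossedProduct.star_single, integrated_single, integrated_single, r.covariant, star_mul,
      map_star, map_inv, ← Unitary.star_eq_inv, Unitary.coe_star]
  | add f h hf hh => simp only [star_add, map_add, hf, hh]

theorem norm_integrated_le (r : CovariantRep G A) (f : AlgCrossedProduct A G) :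
    ‖r.integrated f‖ ≤ f.sum fun _ a => ‖a‖ := by
  have h1 : r.integrated f =
      ∑ g ∈ f.support, r.π (f.coeff g) * (r.U g : r.H →L[ℂ] r.H) := by
    conv_lhs => rw [← SkewMonoidAlgebra.sum_single f]
    rw [SkewMonoidAlgebra.sum_def', map_sum]
    exact Finset.sum_congr rfl fun g _ => integrated_single r g _
  rw [h1, SkewMonoidAlgebra.sum_def']
  refine (norm_sum_le _ _).trans (Finset.sum_le_sum fun g _ => ?_)
  rw [CStarRing.norm_mul_coe_unitary]
  exact NonUnitalStarAlgHom.norm_apply_le r.π _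

end CovariantRep

namespace AlgCrossedProduct

variable {A : Type u} {G : Type v} [Group G] [CStarAlgebra A] [CStarAction G A]

/-- The universal (full) C*-seminorm: the supremum of `‖∑ π(a_g) U_g‖` over all covariant
representations. -/
instance instNorm : Norm (AlgCrossedProduct A G) where
  norm f := ⨆ r : CovariantRep G A, ‖r.integrated f‖

theorem norm_def (f : AlgCrossedProduct A G) : ‖f‖ = ⨆ r : CovariantRep G A, ‖r.integrated f‖ :=
  rfl

theorem bddAbove (f : AlgCrossedProduct A G) :
    BddAbove (Set.range fun r : CovariantRep G A => ‖r.integrated f‖) :=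
  ⟨f.sum fun _ a => ‖a‖, by rintro _ ⟨r, rfl⟩; exact r.norm_integrated_le f⟩

theorem norm_integrated_le_norm (r : CovariantRep G A) (f : AlgCrossedProduct A G) :
    ‖r.integrated f‖ ≤ ‖f‖ := le_ciSup (bddAbove f) r

theorem norm_nonneg' (f : AlgCrossedProduct A G) : 0 ≤ ‖f‖ :=
  Real.iSup_nonneg fun _ => norm_nonneg _

theorem norm_le' {f : AlgCrossedProduct A G} {C : ℝ} (hC : 0 ≤ C)
    (h : ∀ r : CovariantRep G A, ‖r.integrated f‖ ≤ C) : ‖f‖ ≤ C :=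
  Real.iSup_le h hC

/-- The universal seminorm as a bundled ring seminorm. -/
def ringSeminorm (A : Type u) (G : Type v) [Group G] [CStarAlgebra A] [CStarAction G A] :
    RingSeminorm (AlgCrossedProduct A G) where
  toFun f := ‖f‖
  map_zero' := le_antisymm (norm_le' le_rfl fun r => by simp) (norm_nonneg' _)
  add_le' f h := norm_le' (add_nonneg (norm_nonneg' _) (norm_nonneg' _)) fun r => by
    rw [map_add]
    exact (norm_add_le _ _).trans
      (add_le_add (norm_integrated_le_norm r f) (norm_integrated_le_norm r h))
  neg' f := by simp only [norm_def, map_neg, norm_neg]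
  mul_le' f h := norm_le' (mul_nonneg (norm_nonneg' _) (norm_nonneg' _)) fun r => by
    rw [map_mul]
    exact (norm_mul_le _ _).trans (mul_le_mul (norm_integrated_le_norm r f)
      (norm_integrated_le_norm r h) (norm_nonneg _) (norm_nonneg' _))

instance instSeminormedRing : SeminormedRing (AlgCrossedProduct A G) :=
  { (ringSeminorm A G).toSeminormedRing with
    toNorm := instNorm
    toRing := SkewMonoidAlgebra.instRing }

theorem norm_smul_le' (c : ℂ) (f : AlgCrossedProduct A G) : ‖c • f‖ ≤ ‖c‖ * ‖f‖ :=
  norm_le' (mul_nonneg (norm_nonneg _) (norm_nonneg' _)) fun r => by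
    rw [r.integrated_smul, norm_smul]
    exact mul_le_mul_of_nonneg_left (norm_integrated_le_norm r f) (norm_nonneg _)

instance instNormedAlgebra : NormedAlgebra ℂ (AlgCrossedProduct A G) where
  norm_smul_le := norm_smul_le'

theorem norm_star' (f : AlgCrossedProduct A G) : ‖star f‖ = ‖f‖ := by
  simp only [norm_def, CovariantRep.integrated_star, norm_star]

theorem norm_sq_le (f : AlgCrossedProduct A G) : ‖f‖ * ‖f‖ ≤ ‖star f * f‖ := by
  have h : ‖f‖ ≤ √‖star f * f‖ := norm_le' (Real.sqrt_nonneg _) fun r => by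
    apply Real.le_sqrt_of_sq_le
    rw [sq, ← CStarRing.norm_star_mul_self, ← r.integrated_star, ← map_mul]
    exact norm_integrated_le_norm r _
  calc ‖f‖ * ‖f‖ ≤ √‖star f * f‖ * √‖star f * f‖ :=
        mul_le_mul h h (norm_nonneg' _) (Real.sqrt_nonneg _)
    _ = ‖star f * f‖ := Real.mul_self_sqrt (norm_nonneg' _)

instance instNormedStarGroup : NormedStarGroup (AlgCrossedProduct A G) where
  norm_star_le f := (norm_star' f).le

end AlgCrossedProduct

/-- The (full) crossed product `A ⋊ G`: the Hausdorff completion of the algebraic crossed product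
in the universal C*-seminorm. -/
abbrev CrossedProduct (A : Type u) (G : Type v) [Group G] [CStarAlgebra A] [CStarAction G A] :
    Type (max v u) :=
  UniformSpace.Completion (AlgCrossedProduct A G)

namespace CrossedProduct

open UniformSpace

variable {A : Type u} {G : Type v} [Group G] [CStarAlgebra A] [CStarAction G A]

theorem isometry_star : Isometry (star : AlgCrossedProduct A G → AlgCrossedProduct A G) :=
  Isometry.of_dist_eq fun f h => by
    rw [dist_eq_norm, dist_eq_norm, ← star_sub, AlgCrossedProduct.norm_star']

/-- The involution of the crossed product, extended by continuity. -/
instance instStar : Star (CrossedProduct A G) where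
  star := Completion.map (star : AlgCrossedProduct A G → AlgCrossedProduct A G)

theorem coe_star (f : AlgCrossedProduct A G) :
    ((star f : AlgCrossedProduct A G) : CrossedProduct A G) = star (f : CrossedProduct A G) :=
  (Completion.map_coe isometry_star.uniformContinuous f).symm

instance instContinuousStar : ContinuousStar (CrossedProduct A G) where
  continuous_star := Completion.continuous_map

instance instStarRing : StarRing (CrossedProduct A G) where
  star_involutive x := by
    induction x using Completion.induction_on with
    | hp => exact isClosed_eq (by fun_prop) (by fun_prop)
    | ih f => rw [← coe_star, ← coe_star, star_star]
  star_mul x y := by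
    induction x, y using Completion.induction_on₂ with
    | hp => exact isClosed_eq (by fun_prop) (by fun_prop)
    | ih f h =>
      rw [← coe_star, ← coe_star, ← Completion.coe_mul, ← Completion.coe_mul, ← coe_star, star_mul]
  star_add x y := by
    induction x, y using Completion.induction_on₂ with
    | hp => exact isClosed_eq (by fun_prop) (by fun_prop)
    | ih f h =>
      rw [← coe_star, ← coe_star, ← Completion.coe_add, ← Completion.coe_add, ← coe_star, star_add]

instance instNormedAlgebra : NormedAlgebra ℂ (CrossedProduct A G) where
  norm_smul_le := norm_smul_le

instance instStarModule : StarModule ℂ (CrossedProduct A G) where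
  star_smul c x := by
    induction x using Completion.induction_on with
    | hp =>
      exact isClosed_eq (continuous_star.comp (continuous_const_smul c))
        ((continuous_const_smul (star c)).comp continuous_star)
    | ih f => rw [← Completion.coe_smul, ← coe_star, ← coe_star, ← Completion.coe_smul, star_smul]

instance instCStarRing : CStarRing (CrossedProduct A G) where
  norm_mul_self_le x := by
    induction x using Completion.induction_on with
    | hp => exact isClosed_le (by fun_prop) (by fun_prop)
    | ih f =>
      rw [← coe_star, ← Completion.coe_mul, Completion.norm_coe, Completion.norm_coe]
      exact AlgCrossedProduct.norm_sq_le f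

/-- The crossed product is a unital C*-algebra. -/
instance instCStarAlgebra : CStarAlgebra (CrossedProduct A G) where

/-- The canonical copy of `a : A` in `A ⋊ G`. -/
def incl (G : Type v) [Group G] [CStarAction G A] (a : A) : CrossedProduct A G :=
  ((SkewMonoidAlgebra.single 1 a : AlgCrossedProduct A G) : CrossedProduct A G)

/-- The canonical unitary of `A ⋊ G` implementing `g : G`. -/
def implementer (A : Type u) [CStarAlgebra A] [CStarAction G A] (g : G) : CrossedProduct A G :=
  ((SkewMonoidAlgebra.single g 1 : AlgCrossedProduct A G) : CrossedProduct A G)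

end CrossedProduct

end Crossed

/-! ## Generated C*-algebras and weighted shifts on `ℓ²(ℤ)` -/

section WeightedShift

/-- `C*(S)`: the C*-subalgebra of `B` generated by `1` and `S`. -/
def cstarGen {B : Type*} [CStarAlgebra B] (S : Set B) : StarSubalgebra ℂ B :=
  (StarAlgebra.adjoin ℂ S).topologicalClosure

theorem subset_cstarGen {B : Type*} [CStarAlgebra B] (S : Set B) : S ⊆ cstarGen S :=
  (StarAlgebra.subset_adjoin ℂ S).trans (StarSubalgebra.le_topologicalClosure _)

instance instCStarAlgebraCstarGen {B : Type*} [CStarAlgebra B] (S : Set B) :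
    CStarAlgebra (cstarGen S) :=
  StarSubalgebra.cstarAlgebra _ (h_closed := StarSubalgebra.isClosed_topologicalClosure _)

/-- The Hilbert space `ℓ²(ℤ)`. -/
abbrev L2Z : Type := lp (fun _ : ℤ => ℂ) 2

/-- The standard basis vector `e_j`. -/
def basisVec (j : ℤ) : L2Z := lp.single 2 j 1

theorem memℓp_two_iff (f : ℤ → ℂ) : Memℓp f 2 ↔ Summable fun i => ‖f i‖ ^ 2 := by
  rw [memℓp_gen_iff (by norm_num)]
  norm_num

theorem L2Z.norm_sq (f : L2Z) : ‖f‖ ^ 2 = ∑' i, ‖f i‖ ^ 2 := by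
  have h := lp.norm_rpow_eq_tsum (p := 2) (by norm_num) f
  norm_num at h
  exact h

/-- The vector `f` with its coordinates translated by `n`: `j ↦ f (j - n)`. -/
def translateL2 (n : ℤ) (f : L2Z) : L2Z :=
  ⟨fun j => f (j - n), (memℓp_two_iff _).2 <|
    (Equiv.subRight n).summable_iff.2 ((memℓp_two_iff _).1 (lp.memℓp f))⟩

@[simp] theorem translateL2_apply (n : ℤ) (f : L2Z) (j : ℤ) : translateL2 n f j = f (j - n) := rfl

/-- The bilateral shift as a surjective isometry. -/
def shiftIso : L2Z ≃ₗᵢ[ℂ] L2Z where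
  toFun := translateL2 1
  invFun := translateL2 (-1)
  left_inv f := by ext j; simp
  right_inv f := by ext j; simp
  map_add' f g := by ext j; simp
  map_smul' c f := by ext j; simp
  norm_map' f := by
    have h : ‖translateL2 1 f‖ ^ 2 = ‖f‖ ^ 2 := by
      rw [L2Z.norm_sq, L2Z.norm_sq]
      exact (Equiv.subRight (1 : ℤ)).tsum_eq fun i => ‖f i‖ ^ 2
    exact (sq_eq_sq₀ (norm_nonneg _) (norm_nonneg _)).1 h

/-- The bilateral shift `T e_j = e_{j+1}`, a unitary operator. -/
def shift : unitary (L2Z →L[ℂ] L2Z) := Unitary.linearIsometryEquiv.symm shiftIso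

theorem shift_apply (f : L2Z) (j : ℤ) : (shift : L2Z →L[ℂ] L2Z) f j = f (j - 1) := rfl

theorem shift_basisVec (j : ℤ) : (shift : L2Z →L[ℂ] L2Z) (basisVec j) = basisVec (j + 1) := by
  ext k
  simp [shift_apply, basisVec, lp.single_apply, Pi.single_apply, sub_eq_iff_eq_add]

/-- The diagonal operator `e_j ↦ a_j e_j` of a bounded sequence `a`. -/
def diagOp (a : ℤ → ℂ) (C : ℝ) (ha : ∀ j, ‖a j‖ ≤ C) : L2Z →L[ℂ] L2Z :=
  have hsum (f : L2Z) : Summable fun j => ‖f j‖ ^ 2 := (memℓp_two_iff _).1 (lp.memℓp f)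
  have hle (f : L2Z) (j : ℤ) : ‖a j * f j‖ ^ 2 ≤ C ^ 2 * ‖f j‖ ^ 2 := by
    rw [norm_mul, mul_pow]
    gcongr
    exact ha j
  have hmem (f : L2Z) : Summable fun j => ‖a j * f j‖ ^ 2 :=
    Summable.of_nonneg_of_le (fun _ => by positivity) (hle f) ((hsum f).mul_left _)
  LinearMap.mkContinuous
    { toFun := fun f => ⟨fun j => a j * f j, (memℓp_two_iff _).2 (hmem f)⟩
      map_add' := fun f g => by ext j; exact mul_add _ _ _
      map_smul' := fun c f => by ext j; exact mul_left_comm _ _ _ } C fun f => by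
    have hC : 0 ≤ C := (norm_nonneg _).trans (ha 0)
    refine (sq_le_sq₀ (norm_nonneg _) (by positivity)).1 ?_
    rw [mul_pow, L2Z.norm_sq, L2Z.norm_sq, ← tsum_mul_left]
    exact Summable.tsum_le_tsum (hle f) (hmem f) ((hsum f).mul_left _)

theorem diagOp_apply (a : ℤ → ℂ) (C : ℝ) (ha : ∀ j, ‖a j‖ ≤ C) (f : L2Z) (j : ℤ) :
    diagOp a C ha f j = a j * f j := rfl

variable (x : ℤ → Set.Icc (1 : ℝ) 2)

/-- The diagonal operator `X_i e_j = x_{i+j} e_j`. -/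
def diagX (i : ℤ) : L2Z →L[ℂ] L2Z :=
  diagOp (fun j => ((x (i + j) : ℝ) : ℂ)) 2 fun j => by
    rw [Complex.norm_real, Real.norm_of_nonneg (zero_le_one.trans (x (i + j)).2.1)]
    exact (x (i + j)).2.2

theorem diagX_apply (i : ℤ) (f : L2Z) (j : ℤ) : diagX x i f j = ((x (i + j) : ℝ) : ℂ) * f j := rfl

theorem diagX_basisVec (i j : ℤ) :
    diagX x i (basisVec j) = ((x (i + j) : ℝ) : ℂ) • basisVec j := by
  ext k
  rw [diagX_apply]
  by_cases h : k = j
  · subst h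
    rw [lp.coeFn_smul, Pi.smul_apply, smul_eq_mul]
  · rw [lp.coeFn_smul, Pi.smul_apply, smul_eq_mul]
    simp [basisVec, lp.single_apply, h]

/-- The weighted shift `T_x e_j = x_j e_{j+1}`. -/
def weightedShift : L2Z →L[ℂ] L2Z := (shift : L2Z →L[ℂ] L2Z) * diagX x 0

theorem weightedShift_basisVec (j : ℤ) :
    weightedShift x (basisVec j) = ((x j : ℝ) : ℂ) • basisVec (j + 1) := by
  rw [weightedShift, mul_apply_eq_comp, diagX_basisVec, map_smul, shift_basisVec, zero_add]

/-- The commutative C*-algebra `C(X) = C*(…, X₋₁, X₀, X₁, …)`. -/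
abbrev diagAlg : StarSubalgebra ℂ (L2Z →L[ℂ] L2Z) := cstarGen (Set.range (diagX x))

/-- The generator `X_i` as an element of `C(X)`. -/
def genX (i : ℤ) : diagAlg x := ⟨diagX x i, subset_cstarGen _ ⟨i, rfl⟩⟩

/-- Conjugation `a ↦ Tⁿ a T⁻ⁿ`. -/
def conjShift (n : ℤ) : (L2Z →L[ℂ] L2Z) ≃⋆ₐ[ℂ] (L2Z →L[ℂ] L2Z) :=
  Unitary.conjStarAlgAut ℂ (L2Z →L[ℂ] L2Z) (shift ^ n)

theorem conjShift_apply (n : ℤ) (a : L2Z →L[ℂ] L2Z) :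
    conjShift n a =
      ((shift ^ n : unitary (L2Z →L[ℂ] L2Z)) : L2Z →L[ℂ] L2Z) * a *
        ((shift ^ (-n) : unitary (L2Z →L[ℂ] L2Z)) : L2Z →L[ℂ] L2Z) := by
  rw [conjShift, Unitary.conjStarAlgAut_apply, zpow_neg, ← Unitary.star_eq_inv, Unitary.coe_star]

theorem conjShift_zero (a : L2Z →L[ℂ] L2Z) : conjShift 0 a = a := by
  simp [conjShift]

theorem conjShift_add (m n : ℤ) (a : L2Z →L[ℂ] L2Z) :
    conjShift (m + n) a = conjShift m (conjShift n a) := by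
  simp only [conjShift, zpow_add, map_mul]
  rfl

theorem conjShift_one_diagX (i : ℤ) : conjShift 1 (diagX x i) = diagX x (i - 1) := by
  have h : (shift : L2Z →L[ℂ] L2Z) * diagX x i = diagX x (i - 1) * (shift : L2Z →L[ℂ] L2Z) := by
    ext f j
    simp only [mul_apply_eq_comp, shift_apply, diagX_apply]
    rw [show i + (j - 1) = i - 1 + j by ring]
  rw [conjShift, Unitary.conjStarAlgAut_apply, zpow_one, h, mul_assoc,
    (Unitary.mem_iff.1 shift.2).2, mul_one]

theorem conjShift_diagX (n i : ℤ) : conjShift n (diagX x i) = diagX x (i - n) := by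
  induction n using Int.induction_on generalizing i with
  | zero => simp [conjShift_zero]
  | succ n ih => rw [conjShift_add, conjShift_one_diagX, ih, sub_sub, add_comm]
  | pred n ih =>
    have h : diagX x i = conjShift 1 (diagX x (i + 1)) := by
      rw [conjShift_one_diagX, add_sub_cancel_right]
    rw [h, ← conjShift_add, sub_add_cancel, ih]
    congr 1
    ring

theorem conjShift_mem (n : ℤ) {a : L2Z →L[ℂ] L2Z} (ha : a ∈ diagAlg x) :
    conjShift n a ∈ diagAlg x := by
  have hc : Continuous (conjShift n) := by
    have : (conjShift n : (L2Z →L[ℂ] L2Z) → _) = fun a => _ := funext (conjShift_apply n)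
    rw [this]
    fun_prop
  have h : diagAlg x ≤ (diagAlg x).comap (conjShift n : _ →⋆ₐ[ℂ] (L2Z →L[ℂ] L2Z)) := by
    refine StarSubalgebra.topologicalClosure_minimal (StarAlgebra.adjoin_le ?_)
      ((StarSubalgebra.isClosed_topologicalClosure _).preimage hc)
    rintro _ ⟨i, rfl⟩
    change conjShift n (diagX x i) ∈ diagAlg x
    rw [conjShift_diagX]
    exact subset_cstarGen _ ⟨_, rfl⟩
  exact h ha

/-- The action of `ℤ` on `C(X)` generated by the automorphism `α(a) = T a T⁻¹`. -/
instance instCStarActionDiagAlg : CStarAction (Multiplicative ℤ) (diagAlg x) where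
  smul n a := ⟨conjShift n.toAdd a, conjShift_mem x _ a.2⟩
  one_smul _ := Subtype.ext (conjShift_zero _)
  mul_smul _ _ _ := Subtype.ext (conjShift_add _ _ _)
  smul_zero n := Subtype.ext (map_zero (conjShift n.toAdd))
  smul_add n a b := Subtype.ext (map_add (conjShift n.toAdd) (a : L2Z →L[ℂ] L2Z) b)
  smul_one n := Subtype.ext (map_one (conjShift n.toAdd))
  smul_mul n a b := Subtype.ext (map_mul (conjShift n.toAdd) (a : L2Z →L[ℂ] L2Z) b)
  smul_comm n c a := Subtype.ext (map_smul (conjShift n.toAdd) c (a : L2Z →L[ℂ] L2Z))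
  smul_star_eq n a := Subtype.ext (map_star (conjShift n.toAdd) (a : L2Z →L[ℂ] L2Z))

/-- `α(X_i) = X_{i-1}`. -/
theorem smul_genX (i : ℤ) : Multiplicative.ofAdd (1 : ℤ) • genX x i = genX x (i - 1) :=
  Subtype.ext (conjShift_one_diagX x i)

/-- The space `X`: the closure in `ℂ^ℤ` (product topology) of the set of translates
`b_i = (x_{i+j})_j` of `x`. -/
def orbitClosure : Set (ℤ → ℂ) :=
  closure (Set.range fun i j : ℤ => ((x (i + j) : ℝ) : ℂ))

/-- The `i`-th coordinate function on `X`. -/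
def coordFun (i : ℤ) : C(orbitClosure x, ℂ) where
  toFun y := (y : ℤ → ℂ) i
  continuous_toFun := (continuous_apply i).comp continuous_subtype_val

end WeightedShift

end

noncomputable section

/-! ## Square roots in closed star subalgebras -/

/-! Evaluating continuous functions on X along the orbit (b_j) gives diagonal operators on ℓ²(ℤ)
(`orbitRep`). The orbit is dense, so this representation is faithful, hence isometric with closed
range. The coordinate functions go to the X_i and separate points, so Stone–Weierstrass identifies
the range with C*({X_i}) (`range_orbitRep`). This gives the first claim.

For the second, the inclusion of C(X) and the shift T form a covariant pair, and the point is that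
its integrated form attains the universal norm. The matrix entries of ∑ a_n Tⁿ are the values of the
a_n on the orbit, whence ‖a_n‖ ≤ ‖∑ a_n Tⁿ‖ for every n (`norm_coeff_le_norm_shiftIntegrated`).
Because intervals in ℤ grow only linearly, this coefficient bound alone makes the pair dominate
every covariant representation (`AlgCrossedProduct.norm_le_of_norm_coeff_le`). The action need not
be free, so periodic x is covered too.

Thus C(X) ⋊ ℤ embeds isometrically in the operators on ℓ²(ℤ). The image is C*(T_x): T_x = T X_0 is a
polar decomposition whose positive part is invertible because the weights are at least 1. So C*(T_x)
contains X_0, T and all X_i = T⁻ⁱ X_0 Tⁱ. -/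

theorem StarSubalgebra.mem_of_mul_self_mem {B : Type*} [CStarAlgebra B] [PartialOrder B]
    [StarOrderedRing B] {S : StarSubalgebra ℂ B} (hS : IsClosed (S : Set B)) {a : B}
    (ha : 0 ≤ a) (h : a * a ∈ S) : a ∈ S := by
  have hsa : IsSelfAdjoint (a * a) := by
    simpa only [sq] using (IsSelfAdjoint.of_nonneg ha).pow 2
  have hnn : 0 ≤ a * a := by
    simpa only [(IsSelfAdjoint.of_nonneg ha).star_eq] using star_mul_self_nonneg a
  -- A positive element is the unique positive square root of its square, and continuous functional
  -- calculus stays in the C*-algebra generated by that square.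
  have h1 : a = cfc (fun z : ℂ => ((Real.sqrt z.re : ℝ) : ℂ)) (a * a) := by
    rw [← cfc_real_eq_complex (a := a * a) Real.sqrt hsa, ← cfcₙ_eq_cfc,
      ← CFC.sqrt_eq_real_sqrt _ hnn, CFC.sqrt_mul_self a ha]
  rw [h1]
  exact StarAlgebra.elemental.le_of_mem hS h (cfc_mem_elemental _ _)

/-! ## Diagonal operators as continuous functions on the orbit closure -/

section Diagonal

variable (x : ℤ → Set.Icc (1 : ℝ) 2)

instance compactSpace_orbitClosure : CompactSpace (orbitClosure x) := by
  have hK : IsCompact (Set.univ.pi fun _ : ℤ => Metric.closedBall (0 : ℂ) 2) :=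
    isCompact_univ_pi fun _ => isCompact_closedBall _ _
  refine isCompact_iff_compactSpace.1 (hK.of_isClosed_subset isClosed_closure
    (closure_minimal ?_ hK.isClosed))
  rintro _ ⟨i, rfl⟩ j -
  rw [mem_closedBall_zero_iff, Complex.norm_real,
    Real.norm_of_nonneg (zero_le_one.trans (x (i + j)).2.1)]
  exact (x (i + j)).2.2

/-- The translate `b_i = (x_{i+j})_j` as a point of the orbit closure. -/
def orbitPoint (i : ℤ) : orbitClosure x :=
  ⟨fun j => ((x (i + j) : ℝ) : ℂ), subset_closure ⟨i, rfl⟩⟩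

theorem denseRange_orbitPoint : DenseRange (orbitPoint x) := by
  rw [DenseRange, Subtype.dense_iff, ← Set.range_comp]
  exact subset_rfl

theorem coordFun_orbitPoint (i j : ℤ) : coordFun x i (orbitPoint x j) = ((x (j + i) : ℝ) : ℂ) :=
  rfl

/-- A continuous function on the orbit closure is bounded by its values on the orbit. -/
theorem norm_le_of_orbitPoint (g : C(orbitClosure x, ℂ)) {C : ℝ} (hC : 0 ≤ C)
    (h : ∀ j, ‖g (orbitPoint x j)‖ ≤ C) : ‖g‖ ≤ C := by
  rw [ContinuousMap.norm_le _ hC]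
  intro y
  exact (denseRange_orbitPoint x).induction_on (p := fun y => ‖g y‖ ≤ C) y
    (isClosed_le (by fun_prop) continuous_const) h

theorem norm_basisVec (j : ℤ) : ‖basisVec j‖ = 1 := by
  rw [basisVec, lp.norm_single (by norm_num), norm_one]

theorem basisVec_apply_self (j : ℤ) : basisVec j j = 1 := lp.single_apply_self _ _ _

theorem basisVec_apply_ne {j k : ℤ} (h : k ≠ j) : basisVec j k = 0 := lp.single_apply_ne _ _ _ h

theorem norm_apply_basisVec_le (a : L2Z →L[ℂ] L2Z) (j k : ℤ) : ‖a (basisVec j) k‖ ≤ ‖a‖ := by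
  refine (lp.norm_apply_le_norm (by norm_num) _ _).trans ((a.le_opNorm _).trans ?_)
  rw [norm_basisVec, mul_one]

/-- Evaluation along the orbit of `x`, as a representation of `C(X)` by diagonal operators. -/
def orbitRep : C(orbitClosure x, ℂ) →⋆ₐ[ℂ] (L2Z →L[ℂ] L2Z) where
  toFun g := diagOp (fun j => g (orbitPoint x j)) ‖g‖ fun _ => g.norm_coe_le_norm _
  map_one' := by ext f j; exact one_mul _
  map_mul' g h := by ext f j; exact mul_assoc _ _ _
  map_zero' := by ext f j; exact zero_mul _
  map_add' g h := by ext f j; exact add_mul _ _ _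
  commutes' c := by ext f j; rfl
  map_star' g := by
    rw [ContinuousLinearMap.star_eq_adjoint, ContinuousLinearMap.eq_adjoint_iff]
    intro f h
    rw [lp.inner_eq_tsum, lp.inner_eq_tsum]
    refine tsum_congr fun j => ?_
    rw [diagOp_apply, diagOp_apply, ContinuousMap.star_apply, RCLike.inner_apply',
      RCLike.inner_apply', map_mul, starRingEnd_apply, star_star, starRingEnd_apply]
    ring

theorem orbitRep_apply (g : C(orbitClosure x, ℂ)) (f : L2Z) (j : ℤ) :
    orbitRep x g f j = g (orbitPoint x j) * f j := rfl

/-- The diagonal entries are the values on the orbit, and these determine a continuous function by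
density. -/
theorem orbitRep_injective : Function.Injective (orbitRep x) := by
  intro g h hgh
  refine DFunLike.coe_injective ((denseRange_orbitPoint x).equalizer (by fun_prop) (by fun_prop) ?_)
  ext j
  have := congrArg (fun a : L2Z →L[ℂ] L2Z => a (basisVec j) j) hgh
  simpa only [orbitRep_apply, basisVec_apply_self, mul_one, Function.comp_apply] using this

theorem orbitRep_coordFun (i : ℤ) : orbitRep x (coordFun x i) = diagX x i := by
  ext f j
  rw [orbitRep_apply, diagX_apply, coordFun_orbitPoint, add_comm]

theorem isClosedEmbedding_orbitRep : Topology.IsClosedEmbedding (orbitRep x) :=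
  (NonUnitalStarAlgHom.isometry (orbitRep x) (orbitRep_injective x)).isClosedEmbedding

theorem separatesPoints_adjoin_coordFun :
    (StarAlgebra.adjoin ℂ (Set.range (coordFun x))).SeparatesPoints := by
  intro y z hyz
  obtain ⟨i, hi⟩ := Function.ne_iff.1 (Subtype.coe_injective.ne hyz)
  exact ⟨_, ⟨coordFun x i, StarAlgebra.subset_adjoin ℂ _ ⟨i, rfl⟩, rfl⟩, hi⟩

/-- Stone–Weierstrass: the diagonal algebra is the image of all of `C(X)`. -/
theorem range_orbitRep : (orbitRep x).range = diagAlg x := by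
  -- A closed embedding commutes with closures, so the image of the closure of the polynomials in
  -- the coordinates is the closure of the polynomials in the X_i.
  rw [StarAlgHom.range_eq_map_top,
    ← ContinuousMap.starSubalgebra_topologicalClosure_eq_top_of_separatesPoints _
      (separatesPoints_adjoin_coordFun x),
    ← StarSubalgebra.topologicalClosure_map _ _ (isClosedEmbedding_orbitRep x).isClosedMap
      (isClosedEmbedding_orbitRep x).continuous,
    StarAlgHom.map_adjoin, ← Set.range_comp]
  simp only [Function.comp_def, orbitRep_coordFun]
  rfl

theorem orbitRep_mem (g : C(orbitClosure x, ℂ)) : orbitRep x g ∈ diagAlg x :=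
  range_orbitRep x ▸ ⟨g, rfl⟩

/-- `C(X)` is isomorphic to the algebra generated by the diagonal operators `X_i`. -/
def orbitEquiv : C(orbitClosure x, ℂ) ≃⋆ₐ[ℂ] diagAlg x :=
  StarAlgEquiv.ofBijective ((orbitRep x).codRestrict (diagAlg x) (orbitRep_mem x))
    ⟨fun _ _ h => orbitRep_injective x (congrArg Subtype.val h), fun a => by
      obtain ⟨g, hg⟩ : (a : L2Z →L[ℂ] L2Z) ∈ (orbitRep x).range := by
        rw [range_orbitRep]; exact a.2
      exact ⟨g, Subtype.ext hg⟩⟩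

theorem coe_orbitEquiv (g : C(orbitClosure x, ℂ)) :
    (orbitEquiv x g : L2Z →L[ℂ] L2Z) = orbitRep x g := rfl

theorem orbitEquiv_symm_genX (i : ℤ) : (orbitEquiv x).symm (genX x i) = coordFun x i := by
  rw [StarAlgEquiv.symm_apply_eq]
  exact Subtype.ext (orbitRep_coordFun x i).symm

/-- An element of the diagonal algebra acts diagonally. -/
theorem diagAlg_apply (a : diagAlg x) (f : L2Z) (j : ℤ) :
    (a : L2Z →L[ℂ] L2Z) f j = (orbitEquiv x).symm a (orbitPoint x j) * f j := by
  rw [← orbitRep_apply, ← coe_orbitEquiv, StarAlgEquiv.apply_symm_apply]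

/-- The norm of an element of the diagonal algebra is bounded by its diagonal entries. -/
theorem norm_diagAlg_le (a : diagAlg x) {C : ℝ} (hC : 0 ≤ C)
    (h : ∀ j, ‖(orbitEquiv x).symm a (orbitPoint x j)‖ ≤ C) : ‖a‖ ≤ C := by
  rw [← NonUnitalStarAlgHom.norm_map (orbitEquiv x).symm (orbitEquiv x).symm.injective a]
  exact norm_le_of_orbitPoint x _ hC h

/-- The square root of the coordinate function gives an explicit factorization as b* b. Positivity
is what makes X_0 recoverable from T_x* T_x. -/
theorem diagX_nonneg (i : ℤ) : 0 ≤ diagX x i := by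
  let g : C(orbitClosure x, ℂ) :=
    ⟨fun y => ((Real.sqrt ((coordFun x i) y).re : ℝ) : ℂ), by fun_prop⟩
  have h : diagX x i = star (orbitRep x g) * orbitRep x g := by
    rw [← map_star, ← map_mul]
    ext f j
    rw [orbitRep_apply, diagX_apply, ContinuousMap.mul_apply, ContinuousMap.star_apply]
    change _ = star ((Real.sqrt ((x (j + i) : ℝ) : ℂ).re : ℝ) : ℂ) *
      ((Real.sqrt ((x (j + i) : ℝ) : ℂ).re : ℝ) : ℂ) * f j
    rw [Complex.star_def, Complex.conj_ofReal, ← Complex.ofReal_mul, Complex.ofReal_re,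
      Real.mul_self_sqrt (zero_le_one.trans (x (j + i)).2.1), add_comm]
  rw [h]
  exact star_mul_self_nonneg _

/-- The lower bound 1 on the weights passes from the orbit to its closure, so the coordinate
function vanishes nowhere on X and is invertible in C(X). -/
theorem isUnit_diagX (i : ℤ) : IsUnit (diagX x i) := by
  have h (y : orbitClosure x) : (1 : ℝ) ≤ (coordFun x i y).re :=
    (denseRange_orbitPoint x).induction_on (p := fun y => (1 : ℝ) ≤ (coordFun x i y).re) y
      (isClosed_le continuous_const (by fun_prop)) fun j => (x (j + i)).2.1
  have hu : IsUnit (coordFun x i) := by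
    rw [ContinuousMap.isUnit_iff_forall_ne_zero]
    intro y hy
    have := h y
    rw [hy, Complex.zero_re] at this
    linarith
  rw [← orbitRep_coordFun]
  exact hu.map (orbitRep x)

end Diagonal


/-! ### Growth of supports in ℤ and the universal norm -/

section Amenability

/-- If q < p, then (p / q)^n grows exponentially in n = 2^k, which a linear bound in n cannot
dominate. -/
theorem le_of_forall_pow_two_pow_le {p q K L : ℝ} (hq : 0 ≤ q)
    (h : ∀ k : ℕ, p ^ 2 ^ k ≤ (K * 2 ^ k + L) * q ^ 2 ^ k) : p ≤ q := by
  by_contra! hlt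
  rcases hq.eq_or_lt with rfl | hq0
  -- When q = 0 the quotient is unavailable, but k = 0 already gives p ≤ 0.
  · have := h 0
    simp only [pow_zero, pow_one, mul_zero] at this
    linarith
  have hr : 1 < p / q := (one_lt_div hq0).2 hlt
  have h1 (k : ℕ) : (p / q) ^ 2 ^ k ≤ K * 2 ^ k + L := by
    rw [div_pow, div_le_iff₀ (by positivity)]
    exact h k
  have h2 : Filter.Tendsto (fun n : ℕ => (K * n + L) / (p / q) ^ n) Filter.atTop (nhds 0) := by
    have ha := (tendsto_pow_const_div_const_pow_of_one_lt 1 hr).const_mul K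
    have hb := (tendsto_pow_const_div_const_pow_of_one_lt 0 hr).const_mul L
    convert ha.add hb using 2 <;> [(simp only [pow_one, pow_zero]; ring); simp]
  have h3 := h2.comp (tendsto_pow_atTop_atTop_of_one_lt one_lt_two)
  obtain ⟨k, hk⟩ := (h3.eventually_lt_const one_pos).exists
  rw [Function.comp_apply, div_lt_one (by positivity)] at hk
  push_cast at hk
  exact absurd (h1 k) (not_le.2 hk)

namespace AlgCrossedProduct

variable {A : Type*} [CStarAlgebra A]

/-- `f` is supported in the interval `[-d, d]`. -/
def SupportedIn (d : ℕ) (f : AlgCrossedProduct A (Multiplicative ℤ)) : Prop :=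
  ∀ g ∈ f.support, g.toAdd ∈ Finset.Icc (-(d : ℤ)) d

theorem exists_supportedIn (f : AlgCrossedProduct A (Multiplicative ℤ)) :
    ∃ d, SupportedIn d f := by
  refine ⟨f.support.sup fun g => g.toAdd.natAbs, fun g hg => ?_⟩
  have := Finset.le_sup (f := fun g : Multiplicative ℤ => g.toAdd.natAbs) hg
  rw [Finset.mem_Icc]
  omega

theorem SupportedIn.card_le {d : ℕ} {f : AlgCrossedProduct A (Multiplicative ℤ)}
    (hf : SupportedIn d f) : f.support.card ≤ 2 * d + 1 := by
  calc f.support.card ≤ (Finset.Icc (-(d : ℤ)) d).card :=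
        Finset.card_le_card_of_injOn Multiplicative.toAdd hf (fun _ _ _ _ h => h)
    _ = 2 * d + 1 := by rw [Int.card_Icc]; omega

variable [CStarAction (Multiplicative ℤ) A]

theorem SupportedIn.mul {d e : ℕ} {f h : AlgCrossedProduct A (Multiplicative ℤ)}
    (hf : SupportedIn d f) (hh : SupportedIn e h) : SupportedIn (d + e) (f * h) := by
  intro g hg
  obtain ⟨a, ha, b, hb, rfl⟩ := Finset.mem_mul.1 (SkewMonoidAlgebra.support_mul f h hg)
  have h1 := Finset.mem_Icc.1 (hf a ha)
  have h2 := Finset.mem_Icc.1 (hh b hb)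
  rw [toAdd_mul, Finset.mem_Icc]
  push_cast
  omega

theorem SupportedIn.pow {d : ℕ} {f : AlgCrossedProduct A (Multiplicative ℤ)}
    (hf : SupportedIn d f) (n : ℕ) : SupportedIn (n * d) (f ^ n) := by
  induction n with
  | zero =>
    intro g hg
    rw [pow_zero] at hg
    rw [Finset.mem_singleton.1 (SkewMonoidAlgebra.support_one_subset hg)]
    simp
  | succ n ih =>
    rw [pow_succ, Nat.succ_mul]
    exact ih.mul hf

/-- A covariant representation of `(A, ℤ)` whose norm dominates every Fourier coefficient
dominates every covariant representation: powers of `f* f` have linearly growing support, while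
norms of powers of a self-adjoint element grow exponentially. -/
theorem norm_le_of_norm_coeff_le (s : CovariantRep (Multiplicative ℤ) A)
    (hs : ∀ (f : AlgCrossedProduct A (Multiplicative ℤ)) (g : Multiplicative ℤ),
      ‖f.coeff g‖ ≤ ‖s.integrated f‖)
    (f : AlgCrossedProduct A (Multiplicative ℤ)) : ‖f‖ ≤ ‖s.integrated f‖ := by
  refine norm_le' (norm_nonneg _) fun r => ?_
  -- The norm under `r` is at most the ℓ¹-norm of the coefficients; there are at most 2d + 1 of
  -- them, each bounded by the norm under `s`.
  have key {d : ℕ} {h : AlgCrossedProduct A (Multiplicative ℤ)} (hd : SupportedIn d h) :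
      ‖r.integrated h‖ ≤ (2 * d + 1) * ‖s.integrated h‖ := by
    refine (r.norm_integrated_le h).trans ?_
    rw [SkewMonoidAlgebra.sum_def']
    refine (Finset.sum_le_card_nsmul _ _ _ fun g _ => hs h g).trans ?_
    rw [nsmul_eq_mul]
    gcongr
    exact_mod_cast hd.card_le
  have hsa (t : CovariantRep (Multiplicative ℤ) A) :
      IsSelfAdjoint (t.integrated (star f * f)) := by
    rw [map_mul, t.integrated_star]
    exact IsSelfAdjoint.star_mul_self _
  obtain ⟨d, hd⟩ := exists_supportedIn (star f * f)
  have h1 : ‖r.integrated (star f * f)‖ ≤ ‖s.integrated (star f * f)‖ := by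
    -- The 2^k-th power is supported in [-2^k d, 2^k d], so the number of coefficients is at most 2d
    -- · 2^k + 1. Exponents 2^k are used because the C*-identity makes ‖b^(2^k)‖ = ‖b‖^(2^k) for
    -- self-adjoint b.
    refine le_of_forall_pow_two_pow_le (K := 2 * d) (L := 1) (norm_nonneg _)
      fun k => ?_
    rw [← (hsa r).norm_pow_two_pow, ← (hsa s).norm_pow_two_pow, ← map_pow, ← map_pow]
    refine (key (hd.pow (2 ^ k))).trans_eq ?_
    push_cast
    ring
  rw [map_mul, map_mul, r.integrated_star, s.integrated_star, CStarRing.norm_star_mul_self,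
    CStarRing.norm_star_mul_self] at h1
  exact (mul_self_le_mul_self_iff (norm_nonneg _) (norm_nonneg _)).2 h1

end AlgCrossedProduct

end Amenability

/-! ## Extending an isometric covariant representation to the crossed product -/

namespace CovariantRep

open UniformSpace

variable {A : Type*} {G : Type*} [Group G] [CStarAlgebra A] [CStarAction G A]

theorem continuous_integrated (r : CovariantRep G A) : Continuous r.integrated :=
  (LipschitzWith.of_dist_le_mul (K := 1) fun f h => by
    rw [dist_eq_norm, dist_eq_norm, ← map_sub, NNReal.coe_one, one_mul]
    exact AlgCrossedProduct.norm_integrated_le_norm r _).continuous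

/-- The extension of the integrated form to the crossed product. -/
def extend (r : CovariantRep G A) : CrossedProduct A G →⋆ₐ[ℂ] (r.H →L[ℂ] r.H) :=
  have hc := r.continuous_integrated
  have he : Continuous (Completion.extensionHom r.integrated hc) := Completion.continuous_extension
  { Completion.extensionHom r.integrated hc with
    commutes' := fun c => by
      change Completion.extensionHom r.integrated hc _ = _
      rw [Algebra.algebraMap_eq_smul_one, Algebra.algebraMap_eq_smul_one, ← Completion.coe_one,
        ← Completion.coe_smul, Completion.extensionHom_coe, r.integrated_smul, map_one]
    map_star' := fun b => by
      change Completion.extensionHom r.integrated hc _ =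
        star (Completion.extensionHom r.integrated hc _)
      induction b using Completion.induction_on with
      | hp => exact isClosed_eq (he.comp continuous_star) (continuous_star.comp he)
      | ih f =>
        rw [← CrossedProduct.coe_star, Completion.extensionHom_coe, Completion.extensionHom_coe,
          r.integrated_star] }

theorem extend_coe (r : CovariantRep G A) (f : AlgCrossedProduct A G) :
    r.extend (f : CrossedProduct A G) = r.integrated f :=
  Completion.extensionHom_coe _ r.continuous_integrated _

theorem continuous_extend (r : CovariantRep G A) : Continuous r.extend :=
  Completion.continuous_extension

/-- Only this one inequality has to be assumed: the other is built into the universal norm as a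
supremum. -/
theorem isometry_extend (r : CovariantRep G A) (h : ∀ f, ‖f‖ ≤ ‖r.integrated f‖) :
    Isometry r.extend := by
  refine AddMonoidHomClass.isometry_of_norm _ fun b => ?_
  induction b using Completion.induction_on with
  | hp => exact isClosed_eq (by have := r.continuous_extend; fun_prop) (by fun_prop)
  | ih f =>
    rw [extend_coe, Completion.norm_coe]
    exact le_antisymm (AlgCrossedProduct.norm_integrated_le_norm r f) (h f)

end CovariantRep

/-! ## The covariant representation on `ℓ²(ℤ)` -/

section Shift

variable (x : ℤ → Set.Icc (1 : ℝ) 2)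

theorem shift_zpow_apply (n : ℤ) (f : L2Z) (j : ℤ) :
    ((shift ^ n : unitary (L2Z →L[ℂ] L2Z)) : L2Z →L[ℂ] L2Z) f j = f (j - n) := by
  have hinv (f : L2Z) (j : ℤ) : ((shift⁻¹ : unitary (L2Z →L[ℂ] L2Z)) : L2Z →L[ℂ] L2Z) f j
      = f (j + 1) := by
    have h : ((shift * shift⁻¹ : unitary (L2Z →L[ℂ] L2Z)) : L2Z →L[ℂ] L2Z) f (j + 1)
        = f (j + 1) := by
      rw [mul_inv_cancel]; rfl
    rw [Submonoid.coe_mul, mul_apply_eq_comp, shift_apply, add_sub_cancel_right] at h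
    exact h
  induction n generalizing f j with
  | zero => simp
  | succ n ih =>
    rw [zpow_add, zpow_one, Submonoid.coe_mul, mul_apply_eq_comp, ih, shift_apply, sub_sub]
  | pred n ih =>
    rw [zpow_sub, zpow_one, Submonoid.coe_mul, mul_apply_eq_comp, ih, hinv]
    rw [show j - -(n : ℤ) + 1 = j - (-n - 1) by ring]

/-- The identity representation of `C(X)` on `ℓ²(ℤ)`, with `ℤ` represented by the shift. -/
def shiftRep : CovariantRep (Multiplicative ℤ) (diagAlg x) where
  H := L2Z
  π := (diagAlg x).subtype
  U := zpowersHom _ shift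
  covariant n a := by
    change conjShift n.toAdd (a : L2Z →L[ℂ] L2Z) *
      ((shift ^ n.toAdd : unitary (L2Z →L[ℂ] L2Z)) : L2Z →L[ℂ] L2Z) =
      ((shift ^ n.toAdd : unitary (L2Z →L[ℂ] L2Z)) : L2Z →L[ℂ] L2Z) * a
    rw [conjShift_apply, mul_assoc, ← Submonoid.coe_mul, ← zpow_add, neg_add_cancel, zpow_zero,
      Submonoid.coe_one, mul_one]

/-- The integrated form `∑ a_n n ↦ ∑ a_n Tⁿ`. -/
def shiftIntegrated : AlgCrossedProduct (diagAlg x) (Multiplicative ℤ) →+* (L2Z →L[ℂ] L2Z) :=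
  (shiftRep x).integrated

/-- The representation of `C(X) ⋊ ℤ` on `ℓ²(ℤ)`. -/
def shiftHom : CrossedProduct (diagAlg x) (Multiplicative ℤ) →⋆ₐ[ℂ] (L2Z →L[ℂ] L2Z) :=
  (shiftRep x).extend

theorem shiftHom_coe (f : AlgCrossedProduct (diagAlg x) (Multiplicative ℤ)) :
    shiftHom x (f : CrossedProduct (diagAlg x) (Multiplicative ℤ)) = shiftIntegrated x f :=
  (shiftRep x).extend_coe f

theorem continuous_shiftHom : Continuous (shiftHom x) := (shiftRep x).continuous_extend

theorem shiftIntegrated_single (n : Multiplicative ℤ) (a : diagAlg x) :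
    shiftIntegrated x (SkewMonoidAlgebra.single n a) = (a : L2Z →L[ℂ] L2Z) *
      ((shift ^ n.toAdd : unitary (L2Z →L[ℂ] L2Z)) : L2Z →L[ℂ] L2Z) :=
  (shiftRep x).integrated_single n a

/-- The matrix entries of `∑ a_n Tⁿ`. -/
theorem shiftIntegrated_entry (f : AlgCrossedProduct (diagAlg x) (Multiplicative ℤ))
    (n : Multiplicative ℤ) (j : ℤ) :
    shiftIntegrated x f (basisVec (j - n.toAdd)) j =
      (orbitEquiv x).symm (f.coeff n) (orbitPoint x j) := by
  induction f using SkewMonoidAlgebra.induction_on' with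
  | single m a =>
    classical
    rw [shiftIntegrated_single, mul_apply_eq_comp, diagAlg_apply, shift_zpow_apply,
      SkewMonoidAlgebra.coeff_single_apply]
    -- Tᵐ sends e_{j-n} to e_{j-n+m}, whose j-th coordinate is nonzero only for m = n.
    split_ifs with h
    · rw [h, basisVec_apply_self, mul_one]
    · rw [basisVec_apply_ne, mul_zero, map_zero, ContinuousMap.zero_apply]
      exact fun h' => h (Multiplicative.toAdd.injective (by omega))
  | add f g hf hg =>
    rw [map_add, SkewMonoidAlgebra.coeff_add, Finsupp.add_apply, map_add, ContinuousMap.add_apply,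
      ← hf, ← hg]
    rfl

/-- A diagonal operator's norm is controlled by its diagonal entries, and each entry of the n-th
coefficient is a matrix entry of the whole sum. -/
theorem norm_coeff_le_norm_shiftIntegrated (f : AlgCrossedProduct (diagAlg x) (Multiplicative ℤ))
    (n : Multiplicative ℤ) : ‖f.coeff n‖ ≤ ‖shiftIntegrated x f‖ := by
  refine norm_diagAlg_le x _ (norm_nonneg _) fun j => ?_
  rw [← shiftIntegrated_entry]
  exact norm_apply_basisVec_le _ _ _

theorem isometry_shiftHom : Isometry (shiftHom x) :=
  (shiftRep x).isometry_extend
    (AlgCrossedProduct.norm_le_of_norm_coeff_le _ (norm_coeff_le_norm_shiftIntegrated x))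

/-! ### Polar decomposition of T_x inside C*(T_x) -/

/-- As T is unitary, T_x* T_x = X_0², and X_0 is its positive square root. -/
theorem diagX_zero_mem : diagX x 0 ∈ cstarGen {weightedShift x} := by
  refine StarSubalgebra.mem_of_mul_self_mem (StarSubalgebra.isClosed_topologicalClosure _)
    (diagX_nonneg x 0) ?_
  have hT : weightedShift x ∈ cstarGen {weightedShift x} := subset_cstarGen _ rfl
  have h : star (weightedShift x) * weightedShift x = diagX x 0 * diagX x 0 := by
    rw [weightedShift, star_mul, (IsSelfAdjoint.of_nonneg (diagX_nonneg x 0)).star_eq, mul_assoc,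
      ← mul_assoc (star _), (Unitary.mem_iff.1 shift.2).1, one_mul]
  exact h ▸ mul_mem (star_mem hT) hT

theorem shift_mem : (shift : L2Z →L[ℂ] L2Z) ∈ cstarGen {weightedShift x} := by
  have : IsClosed (cstarGen {weightedShift x} : Set (L2Z →L[ℂ] L2Z)) :=
    StarSubalgebra.isClosed_topologicalClosure _
  let a : cstarGen {weightedShift x} := ⟨diagX x 0, diagX_zero_mem x⟩
  -- Spectral permanence: an element of a closed star subalgebra that is invertible among all
  -- operators has its inverse in the subalgebra. Hence T = T_x X_0⁻¹ belongs to C*(T_x).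
  obtain ⟨b, hb, -⟩ := isUnit_iff_exists.1
    ((StarSubalgebra.coe_isUnit (a := a)).1 (isUnit_diagX x 0))
  have h : (shift : L2Z →L[ℂ] L2Z) = weightedShift x * b := by
    change _ = (shift : L2Z →L[ℂ] L2Z) * diagX x 0 * (b : L2Z →L[ℂ] L2Z)
    rw [mul_assoc, show diagX x 0 * (b : L2Z →L[ℂ] L2Z) = 1 from
      congrArg Subtype.val hb, mul_one]
  rw [h]
  exact mul_mem (subset_cstarGen _ rfl) b.2

theorem shift_zpow_mem (n : ℤ) :
    ((shift ^ n : unitary (L2Z →L[ℂ] L2Z)) : L2Z →L[ℂ] L2Z) ∈ cstarGen {weightedShift x} := by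
  have hp (n : ℕ) :
      ((shift ^ n : unitary (L2Z →L[ℂ] L2Z)) : L2Z →L[ℂ] L2Z) ∈ cstarGen {weightedShift x} := by
    rw [SubmonoidClass.coe_pow]
    exact pow_mem (shift_mem x) n
  obtain ⟨n, rfl | rfl⟩ := n.eq_nat_or_neg
  · rw [zpow_natCast]
    exact hp n
  · rw [zpow_neg, zpow_natCast, ← Unitary.star_eq_inv, Unitary.coe_star]
    exact star_mem (hp n)

theorem diagAlg_le : diagAlg x ≤ cstarGen {weightedShift x} := by
  refine StarSubalgebra.topologicalClosure_minimal (StarAlgebra.adjoin_le ?_)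
    (StarSubalgebra.isClosed_topologicalClosure _)
  rintro _ ⟨i, rfl⟩
  have h : diagX x i = conjShift (-i) (diagX x 0) := by
    rw [conjShift_diagX, zero_sub, neg_neg]
  rw [h, conjShift_apply]
  exact mul_mem (mul_mem (shift_zpow_mem x _) (diagX_zero_mem x)) (shift_zpow_mem x _)

theorem shiftHom_mem (b : CrossedProduct (diagAlg x) (Multiplicative ℤ)) :
    shiftHom x b ∈ cstarGen {weightedShift x} := by
  induction b using UniformSpace.Completion.induction_on with
  | hp =>
    exact (StarSubalgebra.isClosed_topologicalClosure _).preimage (continuous_shiftHom x)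
  | ih f =>
    rw [shiftHom_coe]
    induction f using SkewMonoidAlgebra.induction_on' with
    | single n a =>
      rw [shiftIntegrated_single]
      exact mul_mem (diagAlg_le x a.2) (shift_zpow_mem x _)
    | add f g hf hg => rw [map_add]; exact add_mem hf hg

theorem shiftHom_incl (a : diagAlg x) :
    shiftHom x (CrossedProduct.incl (Multiplicative ℤ) a) = (a : L2Z →L[ℂ] L2Z) := by
  rw [CrossedProduct.incl, shiftHom_coe, shiftIntegrated_single, toAdd_one,
    zpow_zero, Submonoid.coe_one, mul_one]

theorem shiftHom_implementer :
    shiftHom x (CrossedProduct.implementer (diagAlg x) (Multiplicative.ofAdd (1 : ℤ))) =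
      (shift : L2Z →L[ℂ] L2Z) := by
  rw [CrossedProduct.implementer, shiftHom_coe, shiftIntegrated_single,
    toAdd_ofAdd, zpow_one]
  exact one_mul _

/-- An isometry from a complete space has closed range, so it is enough that the range contains the
single generator T_x = T X_0. -/
theorem le_range_shiftHom :
    cstarGen {weightedShift x} ≤ (shiftHom x).range := by
  refine StarSubalgebra.topologicalClosure_minimal (StarAlgebra.adjoin_le ?_)
    (isometry_shiftHom x).isClosedEmbedding.isClosed_range
  rintro _ rfl
  refine ⟨CrossedProduct.implementer _ (Multiplicative.ofAdd (1 : ℤ)) *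
    CrossedProduct.incl (Multiplicative ℤ) (genX x 0), ?_⟩
  change shiftHom x _ = _
  rw [map_mul, shiftHom_incl, shiftHom_implementer]
  rfl

/-- The crossed product `C(X) ⋊ ℤ` is isomorphic to `C*(T_x)`. -/
def crossedProductEquiv :
    CrossedProduct (diagAlg x) (Multiplicative ℤ) ≃⋆ₐ[ℂ] cstarGen {weightedShift x} :=
  StarAlgEquiv.ofBijective ((shiftHom x).codRestrict _ (shiftHom_mem x))
    ⟨fun _ _ h => (isometry_shiftHom x).injective (congrArg Subtype.val h), fun a => by
      obtain ⟨b, hb⟩ := le_range_shiftHom x a.2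
      exact ⟨b, Subtype.ext hb⟩⟩

end Shift

end

theorem proposition2p4 (x : ℤ → Set.Icc (1 : ℝ) 2) :
    (∃ θ : diagAlg x ≃⋆ₐ[ℂ] C(orbitClosure x, ℂ), ∀ i : ℤ, θ (genX x i) = coordFun x i) ∧
    ∃ φ : CrossedProduct (diagAlg x) (Multiplicative ℤ) ≃⋆ₐ[ℂ] cstarGen {weightedShift x},
      (∀ a : diagAlg x,
        (φ (CrossedProduct.incl (Multiplicative ℤ) a) : L2Z →L[ℂ] L2Z) = a) ∧
      (φ (CrossedProduct.implementer (diagAlg x) (Multiplicative.ofAdd (1 : ℤ))) :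
        L2Z →L[ℂ] L2Z) = shift :=
  ⟨⟨(orbitEquiv x).symm, orbitEquiv_symm_genX x⟩, crossedProductEquiv x,
    shiftHom_incl x, shiftHom_implementer x⟩
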